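/- Let $\mathcal A=(\mathcal P,\mathcal L)$ be a Desargues affine plane: two distinct points lie on exactly one line; through a point outside a line $\ell$ there is exactly one line disjoint from $\ell$; there are three distinct non-collinear points; and Desargues' axiom holds, in its parallel and in its concurrent form. (Lines are sets of points; two lines are parallel if they are equal or disjoint.) Let $O\ne I$ be two points, let $\ell^{OI}$ be the line joining them, and for $A,B\in\ell^{OI}$ let $A+B$ and $A\cdot B$ be the points of $\ell^{OI}$ constructed as follows from an auxiliary point $B_1\notin\ell^{OI}$, where $\ell^{XY}$ is the line joining $X$ and $Y$, and $\ell_{XY}^{Q}$ is the line through $Q$ parallel to $\ell^{XY}$: $$\{P_1\}=\ell_{OI}^{B_1}\cap\ell_{OB_1}^{A},\qquad \{A+B\}=\ell_{BB_1}^{P_1}\cap\ell^{OI};$$ $$\{P_1\}=\ell_{IB_1}^{A}\cap\ell^{OB_1},\qquad \{A\cdot B\}=\ell_{BB_1}^{P_1}\cap\ell^{OI}.$$ Let $-A$ be the point with $A+(-A)=O$, let $A-B=A+(-B)$, for $A\ne O$ let $A^{-1}$ be the point with $A\cdot A^{-1}=I$, and put $O^{-1}=O$ by convention. For $A,B,C,D\in\ell^{OI}$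 let $$c_r(A,B;C,D)=\left[(A-D)^{-1}(B-D)\right]\left[(B-C)^{-1}(A-C)\right].$$ Fix $A,C,D\in\ell^{OI}$, put $f_B(X)=c_r(A,X;C,D)$ for $X\in\ell^{OI}$, and let $\mathcal R^B_4=\{f_B(X)\mid X\in\ell^{OI}\}$. Then for any three elements $f_B(X),f_B(Y),f_B(Z)$ of $\mathcal R^B_4$: 1. $f_B(X)\cdot[f_B(Y)+f_B(Z)]=f_B(X)\cdot f_B(Y)+f_B(X)\cdot f_B(Z)$, and 2. $[f_B(X)+f_B(Y)]\cdot f_B(Z)=f_B(X)\cdot f_B(Z)+f_B(Y)\cdot f_B(Z)$. -/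

import Mathlib

/-- An affine plane on the point set `P`: lines are sets of points. -/
structure AffinePlane (P : Type*) where
  lines : Set (Set P)
  existsUnique_line : ∀ p q : P, p ≠ q → ∃! l : Set P, l ∈ lines ∧ p ∈ l ∧ q ∈ l
  playfair : ∀ (p : P) (l : Set P), l ∈ lines → p ∉ l →
    ∃! m : Set P, m ∈ lines ∧ p ∈ m ∧ l ∩ m = ∅
  exists_triangle : ∃ p q r : P, p ≠ q ∧ q ≠ r ∧ p ≠ r ∧
    ∀ l ∈ lines, ¬ (p ∈ l ∧ q ∈ l ∧ r ∈ l)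

namespace AffinePlane

variable {P : Type*}

/-- A choice of two distinct points `O` and `I` of the plane. -/
structure Frame (𝒜 : AffinePlane P) where
  O : P
  I : P
  ne : O ≠ I

variable (𝒜 : AffinePlane P)

/-- The line joining two distinct points `p` and `q`, as a set of points. -/
def line (p q : P) : Set P := {x | ∃ l ∈ 𝒜.lines, p ∈ l ∧ q ∈ l ∧ x ∈ l}

/-- Parallelism of lines; a line is parallel to itself. -/
def Parallel (l m : Set P) : Prop := l = m ∨ l ∩ m = ∅

/-- The line through `p` parallel to the line `l`, as a set of points. -/
def par (l : Set P) (p : P) : Set P := {x | ∃ m ∈ 𝒜.lines, p ∈ m ∧ Parallel m l ∧ x ∈ m}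

/-- Desargues' axiom, in its parallel and in its concurrent form. The points that span a line are
required to be distinct. -/
def Desargues : Prop :=
  ∀ A B C A' B' C' : P,
    A ≠ A' → B ≠ B' → C ≠ C' →
    A ≠ B → A' ≠ B' → B ≠ C → B' ≠ C' → A ≠ C → A' ≠ C' →
    [𝒜.line A A', 𝒜.line B B', 𝒜.line C C', 𝒜.line A C, 𝒜.line A' C'].Nodup →
    𝒜.line A B ≠ 𝒜.line A' B' → 𝒜.line B C ≠ 𝒜.line B' C' →
    ((Parallel (𝒜.line A A') (𝒜.line B B') ∧ Parallel (𝒜.line B B') (𝒜.line C C')) ∨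
      ∃ p, 𝒜.line A A' ∩ 𝒜.line B B' ∩ 𝒜.line C C' = {p}) →
    Parallel (𝒜.line A B) (𝒜.line A' B') → Parallel (𝒜.line B C) (𝒜.line B' C') →
    Parallel (𝒜.line A C) (𝒜.line A' C')

variable {𝒜}

theorem eq_of_mem {l m : Set P} (hl : l ∈ 𝒜.lines) (hm : m ∈ 𝒜.lines) {p q : P} (h : p ≠ q)
    (hpl : p ∈ l) (hql : q ∈ l) (hpm : p ∈ m) (hqm : q ∈ m) : l = m :=
  (𝒜.existsUnique_line p q h).unique ⟨hl, hpl, hql⟩ ⟨hm, hpm, hqm⟩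

theorem line_eq {l : Set P} (hl : l ∈ 𝒜.lines) {p q : P} (h : p ≠ q)
    (hp : p ∈ l) (hq : q ∈ l) : 𝒜.line p q = l := by
  ext x
  constructor
  · rintro ⟨m, hm, hpm, hqm, hx⟩
    rwa [eq_of_mem hl hm h hp hq hpm hqm]
  · intro hx
    exact ⟨l, hl, hp, hq, hx⟩

theorem line_spec {p q : P} (h : p ≠ q) :
    𝒜.line p q ∈ 𝒜.lines ∧ p ∈ 𝒜.line p q ∧ q ∈ 𝒜.line p q := by
  obtain ⟨l, ⟨hl, hp, hq⟩, -⟩ := 𝒜.existsUnique_line p q h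
  rw [line_eq hl h hp hq]
  exact ⟨hl, hp, hq⟩

theorem Parallel.symm {l m : Set P} (h : Parallel l m) : Parallel m l := by
  rcases h with h | h
  · exact Or.inl h.symm
  · exact Or.inr (by rw [Set.inter_comm]; exact h)

theorem Parallel.eq {l m : Set P} (h : Parallel l m) {p : P} (hl : p ∈ l) (hm : p ∈ m) :
    l = m := by
  rcases h with h | h
  · exact h
  · exact absurd (show p ∈ l ∩ m from ⟨hl, hm⟩) (by rw [h]; exact id)

theorem eq_of_parallel {l m n : Set P} (hl : l ∈ 𝒜.lines) (hm : m ∈ 𝒜.lines) (hn : n ∈ 𝒜.lines)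
    {p : P} (hpm : p ∈ m) (hpn : p ∈ n) (h₁ : Parallel m l) (h₂ : Parallel n l) : m = n := by
  by_cases hp : p ∈ l
  · rw [h₁.eq hpm hp, h₂.eq hpn hp]
  · have key : ∀ k : Set P, p ∈ k → Parallel k l → l ∩ k = ∅ := by
      intro k hk h
      rcases h with h | h
      · exact absurd (h ▸ hk) hp
      · rw [Set.inter_comm]; exact h
    exact (𝒜.playfair p l hl hp).unique ⟨hm, hpm, key m hpm h₁⟩ ⟨hn, hpn, key n hpn h₂⟩

theorem par_eq {l m : Set P} (hl : l ∈ 𝒜.lines) (hm : m ∈ 𝒜.lines) {p : P} (hp : p ∈ m)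
    (h : Parallel m l) : 𝒜.par l p = m := by
  ext x
  constructor
  · rintro ⟨n, hn, hpn, hnl, hx⟩
    rwa [eq_of_parallel hl hm hn hp hpn h hnl]
  · intro hx
    exact ⟨m, hm, hp, h, hx⟩

theorem par_spec {l : Set P} (hl : l ∈ 𝒜.lines) (p : P) :
    𝒜.par l p ∈ 𝒜.lines ∧ p ∈ 𝒜.par l p ∧ Parallel (𝒜.par l p) l := by
  by_cases hp : p ∈ l
  · rw [par_eq hl hl hp (Or.inl rfl)]
    exact ⟨hl, hp, Or.inl rfl⟩
  · obtain ⟨m, ⟨hm, hpm, h⟩, -⟩ := 𝒜.playfair p l hl hp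
    have h' : Parallel m l := Or.inr (by rw [Set.inter_comm]; exact h)
    rw [par_eq hl hm hpm h']
    exact ⟨hm, hpm, h'⟩

theorem exists_inter {l m : Set P} (hl : l ∈ 𝒜.lines) (hm : m ∈ 𝒜.lines) (h : ¬ Parallel l m) :
    ∃ p, l ∩ m = {p} := by
  have hne : (l ∩ m).Nonempty := by
    rw [Set.nonempty_iff_ne_empty]
    exact fun h' => h (Or.inr h')
  obtain ⟨p, hp⟩ := hne
  refine ⟨p, Set.eq_singleton_iff_unique_mem.2 ⟨hp, ?_⟩⟩
  intro q hq
  by_contra hqp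
  exact h (Or.inl (eq_of_mem hl hm hqp hq.1 hp.1 hq.2 hp.2))

theorem Parallel.trans' {l m n : Set P} (hl : l ∈ 𝒜.lines) (hm : m ∈ 𝒜.lines) (hn : n ∈ 𝒜.lines)
    (h₁ : Parallel l m) (h₂ : Parallel m n) : Parallel l n := by
  by_cases h : l ∩ n = ∅
  · exact Or.inr h
  · obtain ⟨p, hp⟩ := Set.nonempty_iff_ne_empty.2 h
    exact Or.inl (eq_of_parallel hm hl hn hp.1 hp.2 h₁ h₂.symm)

theorem exists_par_inter {l m : Set P} (hl : l ∈ 𝒜.lines) (hm : m ∈ 𝒜.lines)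
    (h : ¬ Parallel l m) (p : P) : ∃ r, 𝒜.par l p ∩ m = {r} := by
  obtain ⟨h₁, -, h₂⟩ := par_spec hl p
  exact exists_inter h₁ hm fun h' => h (Parallel.trans' hl h₁ hm h₂.symm h')

namespace Frame

variable (F : 𝒜.Frame)

/-- The points of the line `OI`. -/
def Point : Type _ := ↥(𝒜.line F.O F.I)

variable {F}

/-- `C` arises from `A` and `B` by the addition construction, for some auxiliary point `B₁`
outside the line `OI`. -/
def IsSum (A B C : F.Point) : Prop :=
  ∃ B₁ ∉ 𝒜.line F.O F.I, ∃ P₁ : P,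
    𝒜.par (𝒜.line F.O F.I) B₁ ∩ 𝒜.par (𝒜.line F.O B₁) A.1 = {P₁} ∧
    𝒜.par (𝒜.line B.1 B₁) P₁ ∩ 𝒜.line F.O F.I = {C.1}

/-- `C` arises from `A` and `B` by the multiplication construction, for some auxiliary point `B₁`
outside the line `OI`. -/
def IsProd (A B C : F.Point) : Prop :=
  ∃ B₁ ∉ 𝒜.line F.O F.I, ∃ P₁ : P,
    𝒜.par (𝒜.line F.I B₁) A.1 ∩ 𝒜.line F.O B₁ = {P₁} ∧
    𝒜.par (𝒜.line B.1 B₁) P₁ ∩ 𝒜.line F.O F.I = {C.1}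

instance : Zero F.Point := ⟨⟨F.O, (line_spec F.ne).2.1⟩⟩

instance : One F.Point := ⟨⟨F.I, (line_spec F.ne).2.2⟩⟩

variable (F) in
theorem exists_notMem : ∃ B₁, B₁ ∉ 𝒜.line F.O F.I := by
  obtain ⟨p, q, r, -, -, -, h⟩ := 𝒜.exists_triangle
  by_contra! h'
  exact h _ (line_spec F.ne).1 ⟨h' p, h' q, h' r⟩

theorem ne_of_notMem (A : F.Point) {Q : P} (hQ : Q ∉ 𝒜.line F.O F.I) : A.1 ≠ Q :=
  fun h => hQ (h ▸ A.2)

theorem not_parallel (A : F.Point) {Q : P} (hQ : Q ∉ 𝒜.line F.O F.I) :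
    ¬ Parallel (𝒜.line A.1 Q) (𝒜.line F.O F.I) := by
  intro h
  obtain ⟨-, h₁, h₂⟩ := line_spec (𝒜 := 𝒜) (ne_of_notMem A hQ)
  exact hQ (h.eq h₁ A.2 ▸ h₂)

theorem exists_last (B : F.Point) {B₁ : P} (hB : B₁ ∉ 𝒜.line F.O F.I) (P₁ : P) :
    ∃ C : F.Point, 𝒜.par (𝒜.line B.1 B₁) P₁ ∩ 𝒜.line F.O F.I = {C.1} := by
  obtain ⟨r, hr⟩ := exists_par_inter (line_spec (ne_of_notMem B hB)).1 (line_spec F.ne).1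
    (not_parallel B hB) P₁
  have : r ∈ 𝒜.par (𝒜.line B.1 B₁) P₁ ∩ 𝒜.line F.O F.I := by rw [hr]; rfl
  exact ⟨⟨r, this.2⟩, hr⟩

theorem exists_last' (C : F.Point) {B₁ P₁ : P} (hB : B₁ ∉ 𝒜.line F.O F.I)
    (hP : P₁ ∉ 𝒜.line F.O F.I) :
    ∃ N : F.Point, 𝒜.par (𝒜.line N.1 B₁) P₁ ∩ 𝒜.line F.O F.I = {C.1} := by
  obtain ⟨N, hN⟩ := exists_last C hP B₁
  have hC := line_spec (𝒜 := 𝒜) (ne_of_notMem C hP)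
  have hp := par_spec hC.1 B₁
  have hN' : N.1 ∈ 𝒜.par (𝒜.line C.1 P₁) B₁ ∩ 𝒜.line F.O F.I := by rw [hN]; rfl
  refine ⟨N, ?_⟩
  rw [line_eq hp.1 (ne_of_notMem N hB) hN'.1 hp.2.1, par_eq hp.1 hC.1 hC.2.2 hp.2.2.symm]
  obtain ⟨r, hr⟩ := exists_inter hC.1 (line_spec F.ne).1 (not_parallel C hP)
  have : C.1 ∈ ({r} : Set P) := hr ▸ ⟨hC.2.1, C.2⟩
  rw [hr, Set.mem_singleton_iff.1 this]

theorem exists_sum_aux (A : F.Point) {B₁ : P} (hB : B₁ ∉ 𝒜.line F.O F.I) :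
    ∃ P₁, 𝒜.par (𝒜.line F.O F.I) B₁ ∩ 𝒜.par (𝒜.line F.O B₁) A.1 = {P₁} := by
  have hO := line_spec (𝒜 := 𝒜) (ne_of_notMem (0 : F.Point) hB)
  have hp := par_spec hO.1 A.1
  refine exists_par_inter (line_spec F.ne).1 hp.1 (fun h => ?_) B₁
  exact not_parallel (0 : F.Point) hB
    (Parallel.trans' hO.1 hp.1 (line_spec F.ne).1 hp.2.2.symm h.symm)

theorem exists_prod_aux (A : F.Point) {B₁ : P} (hB : B₁ ∉ 𝒜.line F.O F.I) :
    ∃ P₁, 𝒜.par (𝒜.line F.I B₁) A.1 ∩ 𝒜.line F.O B₁ = {P₁} := by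
  have hO := line_spec (𝒜 := 𝒜) (ne_of_notMem (0 : F.Point) hB)
  have hI := line_spec (𝒜 := 𝒜) (ne_of_notMem (1 : F.Point) hB)
  refine exists_par_inter hI.1 hO.1 (fun h => ?_) A.1
  have he := h.eq hI.2.2 hO.2.2
  have h1 : F.I ∈ 𝒜.line F.O B₁ := he ▸ hI.2.1
  apply hB
  rw [line_eq hO.1 F.ne hO.2.1 h1]
  exact hO.2.2

theorem exists_isSum (A B : F.Point) : ∃ C, IsSum A B C := by
  obtain ⟨B₁, hB⟩ := F.exists_notMem
  obtain ⟨P₁, h₁⟩ := exists_sum_aux A hB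
  obtain ⟨C, h₂⟩ := exists_last B hB P₁
  exact ⟨C, B₁, hB, P₁, h₁, h₂⟩

theorem exists_isProd (A B : F.Point) : ∃ C, IsProd A B C := by
  obtain ⟨B₁, hB⟩ := F.exists_notMem
  obtain ⟨P₁, h₁⟩ := exists_prod_aux A hB
  obtain ⟨C, h₂⟩ := exists_last B hB P₁
  exact ⟨C, B₁, hB, P₁, h₁, h₂⟩

theorem exists_neg (A : F.Point) : ∃ N, IsSum A N 0 := by
  obtain ⟨B₁, hB⟩ := F.exists_notMem
  obtain ⟨P₁, h₁⟩ := exists_sum_aux A hB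
  have hP : P₁ ∉ 𝒜.line F.O F.I := by
    intro h
    have h' : P₁ ∈ 𝒜.par (𝒜.line F.O F.I) B₁ ∩ 𝒜.par (𝒜.line F.O B₁) A.1 := by rw [h₁]; rfl
    have hp := par_spec (line_spec (𝒜 := 𝒜) F.ne).1 B₁
    exact hB (hp.2.2.eq h'.1 h ▸ hp.2.1)
  obtain ⟨N, h₂⟩ := exists_last' 0 hB hP
  exact ⟨N, B₁, hB, P₁, h₁, h₂⟩

theorem exists_inv (A : F.Point) (hA : A ≠ 0) : ∃ N, IsProd A N 1 := by
  obtain ⟨B₁, hB⟩ := F.exists_notMem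
  obtain ⟨P₁, h₁⟩ := exists_prod_aux A hB
  have hP : P₁ ∉ 𝒜.line F.O F.I := by
    intro h
    have h' : P₁ ∈ 𝒜.par (𝒜.line F.I B₁) A.1 ∩ 𝒜.line F.O B₁ := by rw [h₁]; rfl
    have hl := line_spec (𝒜 := 𝒜) F.ne
    have hO := line_spec (𝒜 := 𝒜) (ne_of_notMem (0 : F.Point) hB)
    have hI := line_spec (𝒜 := 𝒜) (ne_of_notMem (1 : F.Point) hB)
    have hp := par_spec hI.1 A.1
    have hPO : P₁ = F.O := by
      by_contra hne
      exact hB ((eq_of_mem hO.1 hl.1 hne h'.2 hO.2.1 h hl.2.1) ▸ hO.2.2)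
    have hAO : A.1 ≠ F.O := fun e => hA (Subtype.ext e)
    have he : 𝒜.par (𝒜.line F.I B₁) A.1 = 𝒜.line F.O F.I :=
      eq_of_mem hp.1 hl.1 hAO hp.2.1 (hPO ▸ h'.1) A.2 hl.2.1
    exact not_parallel (1 : F.Point) hB (he ▸ hp.2.2).symm
  obtain ⟨N, h₂⟩ := exists_last' 1 hB hP
  exact ⟨N, B₁, hB, P₁, h₁, h₂⟩

noncomputable instance : Add F.Point := ⟨fun A B => (exists_isSum A B).choose⟩

noncomputable instance : Mul F.Point := ⟨fun A B => (exists_isProd A B).choose⟩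

/-- `-A` is the point `N` with `A + N = O`. -/
noncomputable instance : Neg F.Point := ⟨fun A => (exists_neg A).choose⟩

noncomputable instance : Sub F.Point := ⟨fun A B => A + -B⟩

open Classical in
/-- For `A ≠ O`, `A⁻¹` is the point `N` with `A · N = I`; by convention `O⁻¹ = O`. -/
noncomputable instance : Inv F.Point :=
  ⟨fun A => if hA : A ≠ 0 then (exists_inv A hA).choose else 0⟩

/-- The cross ratio `c_r(A, B; C, D)`. -/
noncomputable def crossRatio (A B C D : F.Point) : F.Point :=
  ((A - D)⁻¹ * (B - D)) * ((B - C)⁻¹ * (A - C))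

/-- The set of all cross ratios `f_B(X) = c_r(A, X; C, D)`, where `X` runs over the line `OI`. -/
def crossRatioSetB (A C D : F.Point) : Set F.Point :=
  {R | ∃ X : F.Point, R = crossRatio A X C D}

end Frame

end AffinePlane

/-! Cross ratios are points of the line $OI$, and both laws hold for arbitrary points of that line.
The idea is to replace the constructions by dilatations, maps of the plane that preserve directions.
A dilatation fixing $O$ with $I\mapsto A$ acts on $OI$ as $B\mapsto A\cdot B$ (`mul_coe`); one
moving every point parallel to $OI$ with $O\mapsto A$ acts as $B\mapsto A+B$ (`add_coe`), whatever
auxiliary point was chosen.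

Desargues' axiom supplies these maps (`Pencil.exists_dilatation`, for concurrent and parallel
pencils at once), and two values determine a dilatation (`IsDilatation.ext`). The left law says that
a homothety conjugates a translation into a translation; the right law compares the images of one
auxiliary point.

Translations need at least three parallel lines. If $O$ and $I$ are the only points of $OI$, the
laws are checked by hand. -/

namespace AffinePlane

variable {P : Type*} {𝒜 : AffinePlane P}

/-! ### Calculus of parallels through a point -/

theorem par_self {l : Set P} (hl : l ∈ 𝒜.lines) {p : P} (hp : p ∈ l) : 𝒜.par l p = l :=
  par_eq hl hl hp (Or.inl rfl)

theorem par_congr {l m : Set P} (hl : l ∈ 𝒜.lines) (hm : m ∈ 𝒜.lines) (h : Parallel l m) (p : P) :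
    𝒜.par l p = 𝒜.par m p :=
  have hp := par_spec hm p
  par_eq hl hp.1 hp.2.1 (Parallel.trans' hp.1 hm hl hp.2.2 h.symm)

theorem par_eq_of_mem {l : Set P} (hl : l ∈ 𝒜.lines) {p q : P} (h : q ∈ 𝒜.par l p) :
    𝒜.par l q = 𝒜.par l p :=
  have hp := par_spec hl p
  par_eq hl hp.1 h hp.2.2

theorem mem_par_self {l : Set P} (hl : l ∈ 𝒜.lines) (p : P) : p ∈ 𝒜.par l p :=
  (par_spec hl p).2.1

theorem mem_par_comm {l : Set P} (hl : l ∈ 𝒜.lines) {p q : P} (h : q ∈ 𝒜.par l p) :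
    p ∈ 𝒜.par l q := by
  rw [par_eq_of_mem hl h]
  exact mem_par_self hl p

theorem mem_par_trans {l : Set P} (hl : l ∈ 𝒜.lines) {p q r : P} (h : q ∈ 𝒜.par l p)
    (h' : r ∈ 𝒜.par l q) : r ∈ 𝒜.par l p := by
  rwa [par_eq_of_mem hl h] at h'

theorem mem_par_of_mem {l : Set P} (hl : l ∈ 𝒜.lines) {p q : P} (hp : p ∈ l) (hq : q ∈ l) :
    q ∈ 𝒜.par l p := by
  rwa [par_self hl hp]

theorem mem_of_mem_par {l : Set P} (hl : l ∈ 𝒜.lines) {p q : P} (hp : p ∈ l)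
    (hq : q ∈ 𝒜.par l p) : q ∈ l := by
  rwa [par_self hl hp] at hq

theorem line_parallel_of_mem_par {l : Set P} (hl : l ∈ 𝒜.lines) {p q : P} (h : p ≠ q)
    (hq : q ∈ 𝒜.par l p) : Parallel (𝒜.line p q) l := by
  have hp := par_spec hl p
  rw [line_eq hp.1 h hp.2.1 hq]
  exact hp.2.2

theorem line_comm (p q : P) : 𝒜.line p q = 𝒜.line q p := by
  ext x
  exact ⟨fun ⟨l, h₁, h₂, h₃, h₄⟩ => ⟨l, h₁, h₃, h₂, h₄⟩, fun ⟨l, h₁, h₂, h₃, h₄⟩ => ⟨l, h₁, h₃, h₂, h₄⟩⟩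

theorem not_parallel_of_mem {l m : Set P} {p q : P} (hpl : p ∈ l) (hpm : p ∈ m) (hql : q ∈ l)
    (hqm : q ∉ m) : ¬ Parallel l m :=
  fun h => hqm (h.eq hpl hpm ▸ hql)

theorem eq_of_mem_par {l m : Set P} (hl : l ∈ 𝒜.lines) (hm : m ∈ 𝒜.lines) (h : ¬ Parallel l m)
    {p q x y : P} (hx : x ∈ 𝒜.par l p) (hx' : x ∈ 𝒜.par m q) (hy : y ∈ 𝒜.par l p)
    (hy' : y ∈ 𝒜.par m q) : x = y := by
  by_contra hne
  have h₁ := line_parallel_of_mem_par hl hne (mem_par_trans hl (mem_par_comm hl hx) hy)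
  have h₂ := line_parallel_of_mem_par hm hne (mem_par_trans hm (mem_par_comm hm hx') hy')
  exact h (Parallel.trans' hl (line_spec hne).1 hm h₁.symm h₂)

theorem exists_mem_par {l m : Set P} (hl : l ∈ 𝒜.lines) (hm : m ∈ 𝒜.lines) (h : ¬ Parallel l m)
    (p q : P) : ∃ x, x ∈ 𝒜.par l p ∧ x ∈ 𝒜.par m q := by
  have hq := par_spec hm q
  obtain ⟨r, hr⟩ := exists_par_inter hl hq.1
    (fun h' => h (Parallel.trans' hl hq.1 hm h' hq.2.2)) p
  have : r ∈ 𝒜.par l p ∩ 𝒜.par m q := hr ▸ rfl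
  exact ⟨r, this⟩

theorem exists_notMem_of_mem_lines {l : Set P} (hl : l ∈ 𝒜.lines) : ∃ p, p ∉ l := by
  obtain ⟨p, q, r, -, -, -, h⟩ := 𝒜.exists_triangle
  by_contra! h'
  exact h _ hl ⟨h' p, h' q, h' r⟩

/-! ### Dilatations and their rigidity -/

/-- A map that preserves directions. Constant maps are allowed. -/
def IsDilatation (𝒜 : AffinePlane P) (σ : P → P) : Prop :=
  ∀ l ∈ 𝒜.lines, ∀ x y, y ∈ 𝒜.par l x → σ y ∈ 𝒜.par l (σ x)

theorem isDilatation_id : 𝒜.IsDilatation id := fun _ _ _ _ h => h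

theorem isDilatation_const (p : P) : 𝒜.IsDilatation fun _ => p :=
  fun _ hl _ _ _ => mem_par_self hl p

theorem IsDilatation.comp {σ τ : P → P} (hσ : 𝒜.IsDilatation σ) (hτ : 𝒜.IsDilatation τ) :
    𝒜.IsDilatation (σ ∘ τ) :=
  fun l hl x y h => hσ l hl _ _ (hτ l hl x y h)

theorem IsDilatation.mem_par_line {σ : P → P} (hσ : 𝒜.IsDilatation σ) {p q : P} (h : p ≠ q) :
    σ q ∈ 𝒜.par (𝒜.line p q) (σ p) :=
  have hl := line_spec (𝒜 := 𝒜) h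
  hσ _ hl.1 p q (mem_par_of_mem hl.1 hl.2.1 hl.2.2)

/-- The image of `x` is the intersection of the parallels to `px` and `qx` through the images of `p`
and `q`. -/
theorem IsDilatation.eq_of_notMem {σ τ : P → P} (hσ : 𝒜.IsDilatation σ) (hτ : 𝒜.IsDilatation τ)
    {p q x : P} (h : p ≠ q) (hp : σ p = τ p) (hq : σ q = τ q) (hx : x ∉ 𝒜.line p q) :
    σ x = τ x := by
  have hpq := line_spec (𝒜 := 𝒜) h
  have hpx : p ≠ x := fun e => hx (e ▸ hpq.2.1)
  have hqx : q ≠ x := fun e => hx (e ▸ hpq.2.2)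
  have h₁ := line_spec (𝒜 := 𝒜) hpx
  have h₂ := line_spec (𝒜 := 𝒜) hqx
  refine eq_of_mem_par h₁.1 h₂.1 (not_parallel_of_mem h₁.2.2 h₂.2.2 h₁.2.1 fun hm => ?_)
    (hσ.mem_par_line hpx) (hσ.mem_par_line hqx) (hp ▸ hτ.mem_par_line hpx)
    (hq ▸ hτ.mem_par_line hqx)
  exact hx (eq_of_mem h₂.1 hpq.1 h hm h₂.2.1 hpq.2.1 hpq.2.2 ▸ h₂.2.2)

/-- A dilatation is determined by its values at two points. -/
theorem IsDilatation.ext {σ τ : P → P} (hσ : 𝒜.IsDilatation σ) (hτ : 𝒜.IsDilatation τ) {p q : P}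
    (h : p ≠ q) (hp : σ p = τ p) (hq : σ q = τ q) : σ = τ := by
  funext x
  by_cases hx : x ∈ 𝒜.line p q
  · have hpq := line_spec (𝒜 := 𝒜) h
    -- On the line `pq` the two parallels coincide; a point `s` off that line, where the maps
    -- already agree, replaces `q`.
    obtain ⟨s, hs⟩ := exists_notMem_of_mem_lines hpq.1
    have hps : p ≠ s := fun e => hs (e ▸ hpq.2.1)
    have hl := line_spec (𝒜 := 𝒜) hps
    by_cases hpx : p = x
    · rw [← hpx, hp]
    · refine hσ.eq_of_notMem hτ hps hp (hσ.eq_of_notMem hτ h hp hq hs) fun hx' => hs ?_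
      exact eq_of_mem hl.1 hpq.1 hpx hl.2.1 hx' hpq.2.1 hx ▸ hl.2.2
  · exact hσ.eq_of_notMem hτ h hp hq hx

/-! ### Pencils and the dilatations that preserve their lines -/

/-- A pencil of lines, parallel or concurrent: `center` is the set of its common points, and
`trace x` is the line of the pencil through a point `x` outside the center. -/
structure Pencil (𝒜 : AffinePlane P) where
  center : Set P
  trace : P → Set P
  trace_mem : ∀ x ∉ center, trace x ∈ 𝒜.lines
  mem_trace : ∀ x ∉ center, x ∈ trace x
  center_subset : ∀ x ∉ center, center ⊆ trace x
  trace_eq : ∀ x ∉ center, ∀ y ∉ center, y ∈ trace x → trace y = trace x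
  perspective : ∀ x ∉ center, ∀ y ∉ center, ∀ z ∉ center, y ∉ trace x →
    (Parallel (trace x) (trace y) ∧ Parallel (trace y) (trace z)) ∨
      ∃ p, trace x ∩ trace y ∩ trace z = {p}
  exists_third : ∀ x ∉ center, ∀ y ∉ center, ∃ z ∉ center, z ∉ trace x ∧ z ∉ trace y

namespace Pencil

variable {K : 𝒜.Pencil}

theorem notMem_trace_comm {x y : P} (hx : x ∉ K.center) (hy : y ∉ K.center) (h : y ∉ K.trace x) :
    x ∉ K.trace y :=
  fun h' => h (K.trace_eq y hy x hx h' ▸ K.mem_trace y hy)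

theorem ne_of_notMem_trace {x y : P} (hx : x ∉ K.center) (h : y ∉ K.trace x) : x ≠ y :=
  fun e => h (e ▸ K.mem_trace x hx)

theorem notMem_trace_of_mem {x y x' y' : P} (hx : x ∉ K.center) (hy : y ∉ K.center)
    (hx' : x' ∉ K.center) (hy' : y' ∉ K.center) (h : y ∉ K.trace x) (hxx : x' ∈ K.trace x)
    (hyy : y' ∈ K.trace y) : y' ∉ K.trace x' := by
  rw [K.trace_eq x hx x' hx' hxx]
  intro h'
  rw [← K.trace_eq x hx y' hy' h', K.trace_eq y hy y' hy' hyy] at h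
  exact h (K.mem_trace y hy)

theorem not_parallel {x y : P} (hx : x ∉ K.center) (hy : y ∉ K.center) (h : y ∉ K.trace x) :
    ¬ Parallel (𝒜.line x y) (K.trace y) := by
  have hl := line_spec (𝒜 := 𝒜) (ne_of_notMem_trace hx h)
  exact not_parallel_of_mem hl.2.2 (K.mem_trace y hy) hl.2.1 (notMem_trace_comm hx hy h)

theorem eq_of_mem_trace {x y u v w : P} (hx : x ∉ K.center) (hy : y ∉ K.center)
    (h : y ∉ K.trace x) (hu : u ∈ 𝒜.par (𝒜.line x y) w) (hv : v ∈ 𝒜.par (𝒜.line x y) w)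
    (hu' : u ∈ K.trace y) (hv' : v ∈ K.trace y) : u = v := by
  have ht := K.trace_mem y hy
  have hyy := K.mem_trace y hy
  exact eq_of_mem_par (line_spec (ne_of_notMem_trace hx h)).1 ht (not_parallel hx hy h) hu
    (mem_par_of_mem ht hyy hu') hv (mem_par_of_mem ht hyy hv')

/-- The parallel to `xy` through `x'` cannot meet the center: it would then be `trace x`, forcing
`y` onto that line. -/
theorem exists_lift {x y x' : P} (hx : x ∉ K.center) (hy : y ∉ K.center) (hx' : x' ∉ K.center)
    (h : y ∉ K.trace x) (hxx : x' ∈ K.trace x) :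
    ∃ y' ∉ K.center, y' ∈ K.trace y ∧ y' ∈ 𝒜.par (𝒜.line x y) x' := by
  have hl := line_spec (𝒜 := 𝒜) (ne_of_notMem_trace hx h)
  have ht := K.trace_mem y hy
  have htx := K.trace_mem x hx
  obtain ⟨y', h₁, h₂⟩ := exists_mem_par hl.1 ht (not_parallel hx hy h) x' y
  refine ⟨y', fun hc => ?_, mem_of_mem_par ht (K.mem_trace y hy) h₂, h₁⟩
  have hne : x' ≠ y' := fun e => hx' (e ▸ hc)
  have hp := line_parallel_of_mem_par hl.1 hne h₁
  rw [line_eq htx hne hxx (K.center_subset x hx hc)] at hp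
  exact h (hp.eq (K.mem_trace x hx) hl.2.1 ▸ hl.2.2)

/-- Removes the nondegeneracy conditions of the axiom on the second triangle: a vertex that equals
its image forces the neighbouring vertices to be fixed as well, so either the triangles coincide or
all required points and lines are distinct. -/
theorem desargues (hD : 𝒜.Desargues) {x y z x' y' z' : P} (hx : x ∉ K.center) (hy : y ∉ K.center)
    (hz : z ∉ K.center) (hx' : x' ∉ K.center) (hy' : y' ∉ K.center) (hz' : z' ∉ K.center)
    (hxy : y ∉ K.trace x) (hyz : z ∉ K.trace y) (hxz : z ∉ K.trace x)
    (hxx : x' ∈ K.trace x) (hyy : y' ∈ K.trace y) (hzz : z' ∈ K.trace z)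
    (h₁ : y' ∈ 𝒜.par (𝒜.line x y) x') (h₂ : z' ∈ 𝒜.par (𝒜.line y z) y') :
    z' ∈ 𝒜.par (𝒜.line x z) x' := by
  have lxy := line_spec (𝒜 := 𝒜) (ne_of_notMem_trace hx hxy)
  have lyz := line_spec (𝒜 := 𝒜) (ne_of_notMem_trace hy hyz)
  have lxz := line_spec (𝒜 := 𝒜) (ne_of_notMem_trace hx hxz)
  have tx := K.trace_mem x hx
  have ty := K.trace_mem y hy
  have tz := K.trace_mem z hz
  have mx := K.mem_trace x hx
  have my := K.mem_trace y hy
  have mz := K.mem_trace z hz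
  have hyx := notMem_trace_comm hx hy hxy
  have hzy := notMem_trace_comm hy hz hyz
  have hzx := notMem_trace_comm hx hz hxz
  have hxy' := notMem_trace_of_mem hx hy hx' hy' hxy hxx hyy
  have hyz' := notMem_trace_of_mem hy hz hy' hz' hyz hyy hzz
  have hxz' := notMem_trace_of_mem hx hz hx' hz' hxz hxx hzz
  have nxy' := ne_of_notMem_trace hx' hxy'
  have nyz' := ne_of_notMem_trace hy' hyz'
  have nxz' := ne_of_notMem_trace hx' hxz'
  have up : ∀ {u v : P}, u ∉ K.center → v ∉ K.center → v ∉ K.trace u →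
      ∀ {v'}, v' ∈ K.trace v → v' ∈ 𝒜.par (𝒜.line u v) u → v' = v := by
    intro u v hu hv h v' hv' hp
    have l := line_spec (𝒜 := 𝒜) (ne_of_notMem_trace hu h)
    exact eq_of_mem_trace hu hv h hp (mem_par_of_mem l.1 l.2.1 l.2.2) hv' (K.mem_trace v hv)
  have h₁' : x' ∈ 𝒜.par (𝒜.line y x) y' := line_comm x y ▸ mem_par_comm lxy.1 h₁
  have h₂' : y' ∈ 𝒜.par (𝒜.line z y) z' := line_comm y z ▸ mem_par_comm lyz.1 h₂
  by_cases exx : x = x'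
  · subst exx
    obtain rfl := up hx hy hxy hyy h₁
    obtain rfl := up hy hz hyz hzz h₂
    exact mem_par_of_mem lxz.1 lxz.2.1 lxz.2.2
  by_cases eyy : y = y'
  · subst eyy
    exact absurd (up hy hx hyx hxx h₁').symm exx
  by_cases ezz : z = z'
  · subst ezz
    exact absurd (up hz hy hzy hyy h₂').symm eyy
  have ex := line_eq tx exx mx hxx
  have ey := line_eq ty eyy my hyy
  have ez := line_eq tz ezz mz hzz
  have lxz' := line_spec (𝒜 := 𝒜) nxz'
  have ne_line : ∀ {u v u' v' : P}, u ∉ K.center → v ∉ K.trace u → u' ∈ K.trace u → u ≠ u' →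
      u' ≠ v' → 𝒜.line u v ≠ 𝒜.line u' v' := by
    intro u v u' v' hu h huu hne hne' e
    have l := line_spec (𝒜 := 𝒜) (ne_of_notMem_trace hu h)
    have l' := line_spec (𝒜 := 𝒜) hne'
    exact h (eq_of_mem l.1 (K.trace_mem u hu) hne l.2.1 (e ▸ l'.2.1) (K.mem_trace u hu) huu ▸
      l.2.2)
  have hyx' : x' ∉ K.trace y := by
    rw [← K.trace_eq y hy y' hy' hyy]
    exact notMem_trace_comm hx' hy' hxy'
  have hzx' : x' ∉ K.trace z := by
    rw [← K.trace_eq z hz z' hz' hzz]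
    exact notMem_trace_comm hx' hz' hxz'
  have hxz'' : z' ∉ K.trace x := by
    rwa [← K.trace_eq x hx x' hx' hxx]
  have nodup : [𝒜.line x x', 𝒜.line y y', 𝒜.line z z', 𝒜.line x z, 𝒜.line x' z'].Nodup := by
    rw [ex, ey, ez]
    simp only [List.nodup_cons, List.mem_cons, List.not_mem_nil, or_false, not_or,
      List.nodup_nil, not_false_eq_true, and_true]
    refine ⟨⟨fun e => hxy (e ▸ my), fun e => hxz (e ▸ mz), fun e => hxz (e ▸ lxz.2.2),
      fun e => hxz'' (e ▸ lxz'.2.2)⟩, ⟨fun e => hyz (e ▸ mz), fun e => hyx (e ▸ lxz.2.1),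
      fun e => hyx' (e ▸ lxz'.2.1)⟩, ⟨fun e => hzx (e ▸ lxz.2.1), fun e => hzx' (e ▸ lxz'.2.1)⟩,
      ne_line hx hxz hxx exx nxz'⟩
  have hpar := hD x y z x' y' z' exx eyy ezz (ne_of_notMem_trace hx hxy) nxy'
    (ne_of_notMem_trace hy hyz) nyz' (ne_of_notMem_trace hx hxz) nxz' nodup
    (ne_line hx hxy hxx exx nxy') (ne_line hy hyz hyy eyy nyz')
    (by rw [ex, ey, ez]; exact K.perspective x hx y hy z hz hxy)
    (line_parallel_of_mem_par lxy.1 nxy' h₁).symm (line_parallel_of_mem_par lyz.1 nyz' h₂).symm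
  rw [par_eq lxz.1 lxz'.1 lxz'.2.1 hpar.symm]
  exact lxz'.2.2

/-- Parallels to the lines `ax`, drawn through `a'`, give the image of each `x` off `trace a`.
Desargues' axiom then yields all other directions. -/
theorem exists_dilatation (hD : 𝒜.Desargues) {a a' : P} (ha : a ∉ K.center) (ha' : a' ∉ K.center)
    (haa : a' ∈ K.trace a) :
    ∃ σ : P → P, 𝒜.IsDilatation σ ∧ (∀ x ∈ K.center, σ x = x) ∧
      (∀ x ∉ K.center, σ x ∈ K.trace x) ∧ σ a = a' := by
  -- For points of `trace a` the base pair `a`, `a'` gives no parallel, so a second pair `r`, `r'`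
  -- is used there.
  obtain ⟨r, hr, har, -⟩ := K.exists_third a ha a ha
  obtain ⟨r', hr', hrr, hrp⟩ := exists_lift ha hr ha' har haa
  have hra := notMem_trace_comm ha hr har
  have hspec : ∀ x, ∃ x', (x ∈ K.center → x' = x) ∧ (x ∉ K.center → x' ∉ K.center ∧
      x' ∈ K.trace x ∧ (x ∉ K.trace a → x' ∈ 𝒜.par (𝒜.line a x) a') ∧
      (x ∈ K.trace a → x' ∈ 𝒜.par (𝒜.line r x) r')) := by
    intro x
    by_cases hx : x ∈ K.center
    · exact ⟨x, fun _ => rfl, fun h => absurd hx h⟩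
    by_cases hxa : x ∈ K.trace a
    · have hrx : x ∉ K.trace r := by
        apply notMem_trace_comm hx hr
        rwa [K.trace_eq a ha x hx hxa]
      obtain ⟨x', h₁, h₂, h₃⟩ := exists_lift hr hx hr' hrx hrr
      exact ⟨x', fun h => absurd h hx, fun _ => ⟨h₁, h₂, fun h => absurd hxa h, fun _ => h₃⟩⟩
    · obtain ⟨x', h₁, h₂, h₃⟩ := exists_lift ha hx ha' hxa haa
      exact ⟨x', fun h => absurd h hx, fun _ => ⟨h₁, h₂, fun _ => h₃, fun h => absurd h hxa⟩⟩
  choose σ hσ using hspec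
  have hc : ∀ x ∈ K.center, σ x = x := fun x hx => (hσ x).1 hx
  have hn : ∀ x ∉ K.center, σ x ∉ K.center := fun x hx => ((hσ x).2 hx).1
  have ht : ∀ x ∉ K.center, σ x ∈ K.trace x := fun x hx => ((hσ x).2 hx).2.1
  have hσr : σ r = r' := eq_of_mem_trace ha hr har (((hσ r).2 hr).2.2.1 har) hrp (ht r hr) hrr
  have hσa : σ a = a' := by
    refine eq_of_mem_trace hr ha hra (((hσ a).2 ha).2.2.2 (K.mem_trace a ha)) ?_ (ht a ha) haa
    rw [line_comm r a]
    exact mem_par_comm (line_spec (ne_of_notMem_trace ha har)).1 hrp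
  have step : ∀ {x y z}, x ∉ K.center → y ∉ K.center → z ∉ K.center → y ∉ K.trace x →
      z ∉ K.trace y → z ∉ K.trace x → σ y ∈ 𝒜.par (𝒜.line x y) (σ x) →
      σ z ∈ 𝒜.par (𝒜.line y z) (σ y) → σ z ∈ 𝒜.par (𝒜.line x z) (σ x) :=
    fun {x y z} hx hy hz hxy hyz hxz h₁ h₂ => desargues hD hx hy hz (hn x hx) (hn y hy) (hn z hz)
      hxy hyz hxz (ht x hx) (ht y hy) (ht z hz) h₁ h₂
  have comm : ∀ {x y}, x ∉ K.center → y ∉ K.trace x → σ y ∈ 𝒜.par (𝒜.line x y) (σ x) →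
      σ x ∈ 𝒜.par (𝒜.line y x) (σ y) := fun {x y} hx hxy h =>
    line_comm x y ▸ mem_par_comm (line_spec (ne_of_notMem_trace hx hxy)).1 h
  -- Desargues with `a` as third vertex.
  have hoff : ∀ {x y}, x ∉ K.center → y ∉ K.center → x ∉ K.trace a → y ∉ K.trace a →
      y ∉ K.trace x → σ y ∈ 𝒜.par (𝒜.line x y) (σ x) := by
    intro x y hx hy hxa hya hxy
    have gx : σ x ∈ 𝒜.par (𝒜.line a x) (σ a) := hσa ▸ ((hσ x).2 hx).2.2.1 hxa
    have gy : σ y ∈ 𝒜.par (𝒜.line a y) (σ a) := hσa ▸ ((hσ y).2 hy).2.2.1 hya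
    exact step hx ha hy (notMem_trace_comm ha hx hxa) hya hxy (comm ha hxa gx) gy
  -- Desargues with `r` as third vertex, which must lie off both traces.
  have hon' : ∀ {x y}, x ∉ K.center → y ∉ K.center → x ∈ K.trace a → y ∉ K.trace x →
      y ∉ K.trace r → σ y ∈ 𝒜.par (𝒜.line x y) (σ x) := by
    intro x y hx hy hxa hxy hry
    have hxe := K.trace_eq a ha x hx hxa
    have hxr : r ∉ K.trace x := hxe ▸ har
    have gx : σ x ∈ 𝒜.par (𝒜.line r x) (σ r) := hσr ▸ ((hσ x).2 hx).2.2.2 hxa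
    exact step hx hr hy hxr hry hxy (comm hr (notMem_trace_comm hx hr hxr) gx)
      (hoff hr hy har (hxe ▸ hxy) hry)
  have hon : ∀ {x y}, x ∉ K.center → y ∉ K.center → x ∈ K.trace a → y ∉ K.trace x →
      σ y ∈ 𝒜.par (𝒜.line x y) (σ x) := by
    intro x y hx hy hxa hxy
    by_cases hry : y ∈ K.trace r
    · have hxe := K.trace_eq a ha x hx hxa
      -- Here `r` and `y` share a trace, so a point `s` of a third line of the pencil serves as
      -- intermediate vertex.
      obtain ⟨s, hs, hsx, hsr⟩ := K.exists_third x hx r hr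
      have hys : s ∉ K.trace y := K.trace_eq r hr y hy hry ▸ hsr
      have hsy := notMem_trace_comm hy hs hys
      exact step hx hs hy hsx hsy hxy (hon' hx hs hxa hsx hsr)
        (hoff hs hy (hxe ▸ hsx) (hxe ▸ hxy) hsy)
    · exact hon' hx hy hxa hxy hry
  have main : ∀ {x y}, x ≠ y → σ y ∈ 𝒜.par (𝒜.line x y) (σ x) := by
    intro x y hne
    have l := line_spec (𝒜 := 𝒜) hne
    by_cases hx : x ∈ K.center
    · rw [hc x hx, par_self l.1 l.2.1]
      by_cases hy : y ∈ K.center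
      · rw [hc y hy]
        exact l.2.2
      · rw [line_eq (K.trace_mem y hy) hne (K.center_subset y hy hx) (K.mem_trace y hy)]
        exact ht y hy
    have tx := K.trace_mem x hx
    have mx := K.mem_trace x hx
    by_cases hxy : y ∈ K.trace x
    · rw [line_eq tx hne mx hxy, par_self tx (ht x hx)]
      by_cases hy : y ∈ K.center
      · rwa [hc y hy]
      · exact K.trace_eq x hx y hy hxy ▸ ht y hy
    have hy : y ∉ K.center := fun h => hxy (K.center_subset x hx h)
    by_cases hxa : x ∈ K.trace a
    · exact hon hx hy hxa hxy
    have hyx := notMem_trace_comm hx hy hxy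
    by_cases hya : y ∈ K.trace a
    · exact comm hy hyx (hon hy hx hya hyx)
    · exact hoff hx hy hxa hya hxy
  refine ⟨σ, fun l hl x y hxy => ?_, hc, ht, hσa⟩
  by_cases hne : x = y
  · rw [hne]
    exact mem_par_self hl _
  · rw [← par_congr (line_spec hne).1 hl (line_parallel_of_mem_par hl hne hxy)]
    exact main hne

/-- The pencil of all lines through `p`. -/
def concurrent (𝒜 : AffinePlane P) (p : P) : 𝒜.Pencil where
  center := {p}
  trace x := 𝒜.line p x
  trace_mem x hx := (line_spec (Ne.symm hx)).1
  mem_trace x hx := (line_spec (Ne.symm hx)).2.2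
  center_subset x hx := Set.singleton_subset_iff.2 (line_spec (Ne.symm hx)).2.1
  trace_eq x hx y hy h :=
    have l := line_spec (𝒜 := 𝒜) (Ne.symm hx)
    line_eq l.1 (Ne.symm hy) l.2.1 h
  perspective x hx y hy z hz h := by
    have lx := line_spec (𝒜 := 𝒜) (Ne.symm hx)
    have ly := line_spec (𝒜 := 𝒜) (Ne.symm hy)
    have lz := line_spec (𝒜 := 𝒜) (Ne.symm hz)
    refine Or.inr ⟨p, Set.eq_singleton_iff_unique_mem.2 ⟨⟨⟨lx.2.1, ly.2.1⟩, lz.2.1⟩, ?_⟩⟩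
    rintro q ⟨⟨hqx, hqy⟩, -⟩
    by_contra hq
    exact h (eq_of_mem ly.1 lx.1 hq hqy ly.2.1 hqx lx.2.1 ▸ ly.2.2)
  exists_third x hx y hy := by
    have lx := line_spec (𝒜 := 𝒜) (Ne.symm hx)
    have ly := line_spec (𝒜 := 𝒜) (Ne.symm hy)
    by_cases h : y ∈ 𝒜.line p x
    · obtain ⟨z, hz⟩ := exists_notMem_of_mem_lines lx.1
      refine ⟨z, fun e => hz (e ▸ lx.2.1), hz, ?_⟩
      rwa [line_eq lx.1 (Ne.symm hy) lx.2.1 h]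
    have hxy : x ≠ y := fun e => h (e ▸ lx.2.2)
    have l := line_spec (𝒜 := 𝒜) hxy
    -- The fourth vertex of the parallelogram on `p`, `x`, `y` lies on the parallel to `xy` through
    -- `p`, a third line of the pencil.
    obtain ⟨z, h₁, h₂⟩ := exists_mem_par l.1 lx.1 (not_parallel_of_mem l.2.1 lx.2.2 l.2.2 h) p y
    have hzx : z ∉ 𝒜.line p x := fun hz => h (mem_of_mem_par lx.1 hz (mem_par_comm lx.1 h₂))
    refine ⟨z, fun e => hzx (e ▸ lx.2.1), hzx, fun hzy => ?_⟩
    have hpz : z = y := eq_of_mem_par ly.1 lx.1 (not_parallel_of_mem ly.2.1 lx.2.1 ly.2.2 h)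
      (mem_par_of_mem ly.1 ly.2.2 hzy) h₂ (mem_par_self ly.1 y) (mem_par_self lx.1 y)
    rw [hpz] at h₁
    have hp := mem_of_mem_par l.1 l.2.2 (mem_par_comm l.1 h₁)
    exact h (eq_of_mem l.1 lx.1 (Ne.symm hx) hp l.2.1 lx.2.1 lx.2.2 ▸ l.2.2)

/-- The pencil of all lines parallel to `l`, where the plane has more than two of them. -/
def parallel {l : Set P} (hl : l ∈ 𝒜.lines)
    (h : ∀ x y, ∃ z, z ∉ 𝒜.par l x ∧ z ∉ 𝒜.par l y) : 𝒜.Pencil where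
  center := ∅
  trace x := 𝒜.par l x
  trace_mem x _ := (par_spec hl x).1
  mem_trace x _ := mem_par_self hl x
  center_subset _ _ := Set.empty_subset _
  trace_eq _ _ _ _ h := par_eq_of_mem hl h
  perspective x _ y _ z _ _ := by
    have hx := par_spec hl x
    have hy := par_spec hl y
    have hz := par_spec hl z
    exact Or.inl ⟨Parallel.trans' hx.1 hl hy.1 hx.2.2 hy.2.2.symm,
      Parallel.trans' hy.1 hl hz.1 hy.2.2 hz.2.2.symm⟩
  exists_third x _ y _ := by
    obtain ⟨z, hz⟩ := h x y
    exact ⟨z, id, hz⟩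

end Pencil

/-! ### Homotheties, translations and the supply of parallel lines -/

theorem exists_homothety (hD : 𝒜.Desargues) {p x x' : P} (hx : p ≠ x) (h : x' ∈ 𝒜.line p x) :
    ∃ σ : P → P, 𝒜.IsDilatation σ ∧ σ p = p ∧ σ x = x' := by
  by_cases hx' : x' = p
  · exact ⟨fun _ => p, isDilatation_const p, rfl, hx'.symm⟩
  obtain ⟨σ, h₁, h₂, -, h₃⟩ := Pencil.exists_dilatation (K := Pencil.concurrent 𝒜 p) hD
    (Ne.symm hx) hx' h
  exact ⟨σ, h₁, h₂ p rfl, h₃⟩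

theorem exists_translation (hD : 𝒜.Desargues) {l : Set P} (hl : l ∈ 𝒜.lines)
    (h : ∀ x y, ∃ z, z ∉ 𝒜.par l x ∧ z ∉ 𝒜.par l y) {a a' : P} (haa : a' ∈ 𝒜.par l a) :
    ∃ σ : P → P, 𝒜.IsDilatation σ ∧ (∀ x, σ x ∈ 𝒜.par l x) ∧ σ a = a' := by
  obtain ⟨σ, h₁, -, h₂, h₃⟩ := Pencil.exists_dilatation (K := Pencil.parallel hl h) hD
    (a := a) (a' := a') id id haa
  exact ⟨σ, h₁, fun x => h₂ x id, h₃⟩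

/-- Three points of a transversal lie on three different parallels to `l`, and two of these cannot
cover them. -/
theorem exists_notMem_par {l n : Set P} (hl : l ∈ 𝒜.lines) (hn : n ∈ 𝒜.lines)
    (h : ¬ Parallel n l) {p q r : P} (hp : p ∈ n) (hq : q ∈ n) (hr : r ∈ n) (hpq : p ≠ q)
    (hpr : p ≠ r) (hqr : q ≠ r) (x y : P) : ∃ z, z ∉ 𝒜.par l x ∧ z ∉ 𝒜.par l y := by
  have key : ∀ {u v w : P}, u ∈ n → v ∈ n → u ≠ v → u ∈ 𝒜.par l w → v ∉ 𝒜.par l w := by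
    intro u v w hu hv huv hu' hv'
    have := line_parallel_of_mem_par hl huv (mem_par_trans hl (mem_par_comm hl hu') hv')
    rw [line_eq hn huv hu hv] at this
    exact h this
  by_contra! hall
  by_cases hpx : p ∈ 𝒜.par l x
  · have hqy := hall q (key hp hq hpq hpx)
    exact key hq hr hqr hqy (hall r (key hp hr hpr hpx))
  · have hpy := hall p hpx
    have hqx : q ∈ 𝒜.par l x := by
      by_contra hqx
      exact key hp hq hpq hpy (hall q hqx)
    exact key hp hr hpr hpy (hall r (key hq hr hqr hqx))

/-! ### Sums and products as values of dilatations -/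

namespace Frame

variable {F : 𝒜.Frame}

theorem not_parallel_line_zero_one {b : P} (hb : b ∉ 𝒜.line F.O F.I) :
    ¬ Parallel (𝒜.line F.I b) (𝒜.line F.O b) := by
  have hOI := line_spec (𝒜 := 𝒜) F.ne
  have hO := line_spec (𝒜 := 𝒜) (ne_of_notMem (0 : F.Point) hb)
  have hI := line_spec (𝒜 := 𝒜) (ne_of_notMem (1 : F.Point) hb)
  exact not_parallel_of_mem hI.2.2 hO.2.2 hI.2.1
      fun h' => hb (eq_of_mem hO.1 hOI.1 F.ne hO.2.1 h' hOI.2.1 hOI.2.2 ▸ hO.2.2)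

/-- A third point `E` on $OI$ provides three parallels in every direction: $OI$ itself is the
transversal, unless it is parallel to `l`. -/
theorem exists_notMem_par {E : F.Point} (h0 : E ≠ 0) (h1 : E ≠ 1) {l : Set P} (hl : l ∈ 𝒜.lines)
    (x y : P) : ∃ z, z ∉ 𝒜.par l x ∧ z ∉ 𝒜.par l y := by
  have hOI := line_spec (𝒜 := 𝒜) F.ne
  have hEO : E.1 ≠ F.O := fun e => h0 (Subtype.ext e)
  have hEI : E.1 ≠ F.I := fun e => h1 (Subtype.ext e)
  by_cases h : Parallel (𝒜.line F.O F.I) l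
  · obtain ⟨b, hb⟩ := F.exists_notMem
    have hO := line_spec (𝒜 := 𝒜) (ne_of_notMem (0 : F.Point) hb)
    have hI := line_spec (𝒜 := 𝒜) (ne_of_notMem (1 : F.Point) hb)
    have hnO := not_parallel (0 : F.Point) hb
    have hnI := not_parallel (1 : F.Point) hb
    -- Projecting `E` along `Ib` onto `Ob` gives a third point of that line, which then serves as
    -- the transversal.
    obtain ⟨e, he₁, he₂⟩ := exists_mem_par hI.1 hO.1 (not_parallel_line_zero_one hb) E.1 F.O
    refine AffinePlane.exists_notMem_par hl hO.1
      (fun h' => hnO (Parallel.trans' hO.1 hl hOI.1 h' h.symm)) hO.2.1 hO.2.2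
      (mem_of_mem_par hO.1 hO.2.1 he₂) (ne_of_notMem (0 : F.Point) hb) (fun hOe => ?_)
      (fun hbe => ?_) x y
    · have hOe : F.O = e := hOe
      have := line_parallel_of_mem_par hI.1 hEO (hOe ▸ he₁)
      rw [line_eq hOI.1 hEO E.2 hOI.2.1] at this
      exact hnI this.symm
    · have hE := mem_of_mem_par hI.1 hI.2.2 (mem_par_comm hI.1 (show b ∈ 𝒜.par (𝒜.line F.I b) E.1 by
        rwa [← hbe] at he₁))
      exact hb (eq_of_mem hI.1 hOI.1 hEI hE hI.2.1 E.2 hOI.2.2 ▸ hI.2.2)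
  · exact AffinePlane.exists_notMem_par hl hOI.1 h hOI.2.1 hOI.2.2 E.2 F.ne hEO.symm hEI.symm x y

theorem isSum_add (A B : F.Point) : IsSum A B (A + B) := (exists_isSum A B).choose_spec

theorem isProd_mul (A B : F.Point) : IsProd A B (A * B) := (exists_isProd A B).choose_spec

/-- Coordinate-free form of `IsSum`. -/
theorem IsSum.exists_mem_par {A B C : F.Point} (h : IsSum A B C) :
    ∃ b ∉ 𝒜.line F.O F.I, ∃ p, p ∈ 𝒜.par (𝒜.line F.O F.I) b ∧ p ∈ 𝒜.par (𝒜.line F.O b) A.1 ∧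
      C.1 ∈ 𝒜.par (𝒜.line B.1 b) p := by
  obtain ⟨b, hb, p, h₁, h₂⟩ := h
  have hp : p ∈ 𝒜.par (𝒜.line F.O F.I) b ∩ 𝒜.par (𝒜.line F.O b) A.1 := h₁ ▸ rfl
  have hC : C.1 ∈ 𝒜.par (𝒜.line B.1 b) p ∩ 𝒜.line F.O F.I := h₂ ▸ rfl
  exact ⟨b, hb, p, hp.1, hp.2, hC.1⟩

theorem IsProd.exists_mem_par {A B C : F.Point} (h : IsProd A B C) :
    ∃ b ∉ 𝒜.line F.O F.I, ∃ p, p ∈ 𝒜.par (𝒜.line F.I b) A.1 ∧ p ∈ 𝒜.par (𝒜.line F.O b) F.O ∧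
      C.1 ∈ 𝒜.par (𝒜.line B.1 b) p := by
  obtain ⟨b, hb, p, h₁, h₂⟩ := h
  have hp : p ∈ 𝒜.par (𝒜.line F.I b) A.1 ∩ 𝒜.line F.O b := h₁ ▸ rfl
  have hC : C.1 ∈ 𝒜.par (𝒜.line B.1 b) p ∩ 𝒜.line F.O F.I := h₂ ▸ rfl
  have hO := line_spec (𝒜 := 𝒜) (ne_of_notMem (0 : F.Point) hb)
  exact ⟨b, hb, p, hp.1, mem_par_of_mem hO.1 hO.2.1 hp.2, hC.1⟩

theorem eq_of_mem_par {B C : F.Point} {b p q : P} (hb : b ∉ 𝒜.line F.O F.I)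
    (hC : C.1 ∈ 𝒜.par (𝒜.line B.1 b) p) (hq : q ∈ 𝒜.line F.O F.I)
    (hq' : q ∈ 𝒜.par (𝒜.line B.1 b) p) : C.1 = q := by
  have hOI := line_spec (𝒜 := 𝒜) F.ne
  exact AffinePlane.eq_of_mem_par (line_spec (ne_of_notMem B hb)).1 hOI.1 (not_parallel B hb) hC
    (mem_par_of_mem hOI.1 hOI.2.1 C.2) hq' (mem_par_of_mem hOI.1 hOI.2.1 hq)

/-- The point $P_1$ of the construction is `τ b`, and the last parallel joins `τ b` to `τ B`. This
holds for every auxiliary `b`, so the choice behind `+` does not matter. -/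
theorem add_coe {A : F.Point} {τ : P → P} (hτ : 𝒜.IsDilatation τ)
    (ht : ∀ x, τ x ∈ 𝒜.par (𝒜.line F.O F.I) x) (hA : τ F.O = A.1) (B : F.Point) :
    (A + B).1 = τ B.1 := by
  obtain ⟨b, hb, p, hp, hp', hC⟩ := (isSum_add A B).exists_mem_par
  have hOI := line_spec (𝒜 := 𝒜) F.ne
  have hOb : F.O ≠ b := ne_of_notMem (0 : F.Point) hb
  have hO := line_spec (𝒜 := 𝒜) hOb
  have hB := ne_of_notMem B hb
  have hpb : p = τ b := AffinePlane.eq_of_mem_par hO.1 hOI.1 (not_parallel (0 : F.Point) hb) hp' hp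
    (hA ▸ hτ.mem_par_line hOb) (ht b)
  refine eq_of_mem_par hb hC (mem_of_mem_par hOI.1 B.2 (ht B.1)) (hpb ▸ ?_)
  exact mem_par_comm (line_spec hB).1 (hτ.mem_par_line hB)

theorem dilatation_mem_line {σ : P → P} (hσ : 𝒜.IsDilatation σ) (h0 : σ F.O = F.O) (B : F.Point) :
    σ B.1 ∈ 𝒜.line F.O F.I := by
  have hOI := line_spec (𝒜 := 𝒜) F.ne
  have := hσ _ hOI.1 _ _ (mem_par_of_mem hOI.1 hOI.2.1 B.2)
  rw [h0] at this
  exact mem_of_mem_par hOI.1 hOI.2.1 this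

theorem dilatation_mem_par {σ : P → P} (hσ : 𝒜.IsDilatation σ) (h0 : σ F.O = F.O) {b : P}
    (hb : F.O ≠ b) : σ b ∈ 𝒜.par (𝒜.line F.O b) F.O := by
  have := hσ.mem_par_line hb
  rwa [h0] at this

/-- As for sums, $P_1$ is `σ b`. The constant map at `O` is allowed and covers `A = 0`. -/
theorem mul_coe {A : F.Point} {σ : P → P} (hσ : 𝒜.IsDilatation σ) (h0 : σ F.O = F.O)
    (hA : σ F.I = A.1) (B : F.Point) : (A * B).1 = σ B.1 := by
  obtain ⟨b, hb, p, hp, hp', hC⟩ := (isProd_mul A B).exists_mem_par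
  have hIb : F.I ≠ b := ne_of_notMem (1 : F.Point) hb
  have hOb : F.O ≠ b := ne_of_notMem (0 : F.Point) hb
  have hB := ne_of_notMem B hb
  have hpb : p = σ b := AffinePlane.eq_of_mem_par (line_spec hIb).1 (line_spec hOb).1
    (not_parallel_line_zero_one hb) hp hp' (hA ▸ hσ.mem_par_line hIb)
    (dilatation_mem_par hσ h0 hOb)
  refine eq_of_mem_par hb hC (dilatation_mem_line hσ h0 B) (hpb ▸ ?_)
  exact mem_par_comm (line_spec hB).1 (hσ.mem_par_line hB)

theorem exists_mul_dilatation (hD : 𝒜.Desargues) (A : F.Point) :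
    ∃ σ : P → P, 𝒜.IsDilatation σ ∧ σ F.O = F.O ∧ ∀ B : F.Point, σ B.1 = (A * B).1 := by
  obtain ⟨σ, h₁, h₂, h₃⟩ := exists_homothety hD F.ne A.2
  exact ⟨σ, h₁, h₂, fun B => (mul_coe h₁ h₂ h₃ B).symm⟩

theorem mul_one_of_desargues (hD : 𝒜.Desargues) (A : F.Point) : A * 1 = A := by
  obtain ⟨σ, h₁, h₂, h₃⟩ := exists_homothety hD F.ne A.2
  exact Subtype.ext ((mul_coe h₁ h₂ h₃ 1).trans h₃)

/-- A dilatation `τ` realizing the addition of `A` along the line `OI`. -/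
theorem exists_add_dilatation (hD : 𝒜.Desargues) {E : F.Point} (h0 : E ≠ 0) (h1 : E ≠ 1)
    (A : F.Point) : ∃ τ : P → P, 𝒜.IsDilatation τ ∧ (∀ x, τ x ∈ 𝒜.par (𝒜.line F.O F.I) x) ∧
      τ F.O = A.1 ∧ ∀ B : F.Point, τ B.1 = (A + B).1 := by
  have hOI := line_spec (𝒜 := 𝒜) F.ne
  obtain ⟨τ, h₁, h₂, h₃⟩ := exists_translation hD hOI.1 (exists_notMem_par h0 h1 hOI.1)
    (mem_par_of_mem hOI.1 hOI.2.1 A.2)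
  exact ⟨τ, h₁, h₂, h₃, fun B => (add_coe h₁ h₂ h₃ B).symm⟩

/-! ### The two distributive laws -/

/-- With `σ` multiplication by `A` and `τ`, `ρ` the translations by `B` and `A * B`, one has `σ ∘ τ
= ρ ∘ σ`: both are dilatations agreeing at `O` and at `b`. Evaluate at `C`. -/
theorem mul_add_of_desargues (hD : 𝒜.Desargues) {E : F.Point} (h0 : E ≠ 0) (h1 : E ≠ 1)
    (A B C : F.Point) : A * (B + C) = A * B + A * C := by
  obtain ⟨σ, hσ, hσ0, hσm⟩ := exists_mul_dilatation hD A
  obtain ⟨τ, hτ, hτt, hτ0, hτa⟩ := exists_add_dilatation hD h0 h1 B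
  obtain ⟨ρ, hρ, hρt, hρ0, hρa⟩ := exists_add_dilatation hD h0 h1 (A * B)
  obtain ⟨b, hb⟩ := F.exists_notMem
  have hOI := line_spec (𝒜 := 𝒜) F.ne
  have hOb : F.O ≠ b := ne_of_notMem (0 : F.Point) hb
  have hO := line_spec (𝒜 := 𝒜) hOb
  have e0 : (σ ∘ τ) F.O = (ρ ∘ σ) F.O := by
    simp only [Function.comp_apply, hσ0, hρ0, hτ0, hσm]
  have eb : (σ ∘ τ) b = (ρ ∘ σ) b :=
    AffinePlane.eq_of_mem_par hO.1 hOI.1 (not_parallel (0 : F.Point) hb)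
      ((hσ.comp hτ).mem_par_line hOb) (hσ _ hOI.1 _ _ (hτt b))
      (e0 ▸ (hρ.comp hσ).mem_par_line hOb) (hρt (σ b))
  have h := congrFun (IsDilatation.ext (hσ.comp hτ) (hρ.comp hσ) hOb e0 eb) C.1
  simp only [Function.comp_apply, hτa, hσm, hρa] at h
  exact Subtype.ext h

/-- The pointwise sum of two homotheties is not known to be a dilatation, so only the auxiliary
point `b` is followed: its image under the sum should be `ρ (α b)`, with `ρ` the translation taking
`O` to `β b`. -/
theorem add_mul_of_desargues (hD : 𝒜.Desargues) {E : F.Point} (h0 : E ≠ 0) (h1 : E ≠ 1)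
    (A B C : F.Point) : (A + B) * C = A * C + B * C := by
  obtain ⟨α, hα, hα0, hαm⟩ := exists_mul_dilatation hD A
  obtain ⟨β, hβ, hβ0, hβm⟩ := exists_mul_dilatation hD B
  obtain ⟨b, hb, p, hp, hp', hC⟩ := (isProd_mul (A + B) C).exists_mem_par
  have hOI := line_spec (𝒜 := 𝒜) F.ne
  have hIb : F.I ≠ b := ne_of_notMem (1 : F.Point) hb
  have hOb : F.O ≠ b := ne_of_notMem (0 : F.Point) hb
  have hO := line_spec (𝒜 := 𝒜) hOb
  obtain ⟨ρ, hρ, hρt, hρ0⟩ := exists_translation hD hO.1 (exists_notMem_par h0 h1 hO.1)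
    (dilatation_mem_par hβ hβ0 hOb)
  -- The line through `ρ (α b)` in direction `Xb` contains `A * X + B * X`, and `ρ (α b)` does not
  -- depend on `X`.
  have key : ∀ X : F.Point, (A * X + B * X).1 ∈ 𝒜.par (𝒜.line X.1 b) (ρ (α b)) := by
    intro X
    obtain ⟨τ, hτ, hτt, hτ0, hτa⟩ := exists_add_dilatation hD h0 h1 (A * X)
    have hX := ne_of_notMem X hb
    have lX := line_spec (𝒜 := 𝒜) hX
    -- Both are the fourth vertex of the parallelogram on `O`, `A * X` and `β b`.
    have e : τ (β b) = ρ (A * X).1 := by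
      refine AffinePlane.eq_of_mem_par hO.1 hOI.1 (not_parallel (0 : F.Point) hb)
        (p := (A * X).1) (q := β b) ?_ (hτt _) (hρt _) ?_
      · exact hτ0 ▸ hτ _ hO.1 _ _ (dilatation_mem_par hβ hβ0 hOb)
      · exact hρ0 ▸ hρ _ hOI.1 _ _ (mem_par_of_mem hOI.1 hOI.2.1 (A * X).2)
    have t₁ : ρ (A * X).1 ∈ 𝒜.par (𝒜.line X.1 b) (ρ (α b)) := by
      rw [← hαm]
      exact mem_par_comm lX.1 ((hρ.comp hα).mem_par_line hX)
    have t₂ : (A * X + B * X).1 ∈ 𝒜.par (𝒜.line X.1 b) (τ (β b)) := by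
      rw [← hτa, ← hβm]
      exact mem_par_comm lX.1 ((hτ.comp hβ).mem_par_line hX)
    exact mem_par_trans lX.1 t₁ (e ▸ t₂)
  -- `X = 1` identifies `ρ (α b)` as the point $P_1$ in the construction of `(A + B) * C`; `X = C`
  -- then gives the result.
  have hpb : p = ρ (α b) := by
    refine AffinePlane.eq_of_mem_par (line_spec hIb).1 hO.1 (not_parallel_line_zero_one hb) hp hp'
      (mem_par_comm (line_spec hIb).1 ?_) (mem_par_trans hO.1 (dilatation_mem_par hα hα0 hOb)
        (hρt _))
    have := key 1
    rwa [mul_one_of_desargues hD, mul_one_of_desargues hD] at this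
  exact Subtype.ext (eq_of_mem_par hb hC (A * C + B * C).2 (hpb ▸ key C))

/-! ### Neutral elements and the line with two points -/

theorem zero_add_point (A : F.Point) : 0 + A = A :=
  Subtype.ext (add_coe isDilatation_id (fun x => mem_par_self (line_spec F.ne).1 x) rfl A)

theorem zero_mul_point (A : F.Point) : 0 * A = 0 :=
  Subtype.ext (mul_coe (isDilatation_const F.O) rfl rfl A)

theorem one_mul_point (A : F.Point) : 1 * A = A :=
  Subtype.ext (mul_coe isDilatation_id rfl rfl A)

theorem add_zero_point (A : F.Point) : A + 0 = A := by
  obtain ⟨b, hb, p, -, hp, hC⟩ := (isSum_add A 0).exists_mem_par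
  exact Subtype.ext (eq_of_mem_par hb hC A.2
    (mem_par_comm (line_spec (ne_of_notMem (0 : F.Point) hb)).1 hp))

/-- If the sum were `I`, then $P_1$ would be `b`, making `Ib` parallel to `Ob`. -/
theorem one_add_one_ne_one : (1 : F.Point) + 1 ≠ 1 := by
  intro h
  obtain ⟨b, hb, p, hp, hp', hC⟩ := (isSum_add (1 : F.Point) 1).exists_mem_par
  rw [h] at hC
  have hOI := line_spec (𝒜 := 𝒜) F.ne
  have hI := line_spec (𝒜 := 𝒜) (ne_of_notMem (1 : F.Point) hb)
  have hO := line_spec (𝒜 := 𝒜) (ne_of_notMem (0 : F.Point) hb)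
  have hpb : p = b := AffinePlane.eq_of_mem_par hI.1 hOI.1 (not_parallel (1 : F.Point) hb)
    (mem_par_comm hI.1 hC) hp (mem_par_of_mem hI.1 hI.2.1 hI.2.2) (mem_par_self hOI.1 b)
  exact not_parallel_line_zero_one hb
    (line_parallel_of_mem_par hO.1 (ne_of_notMem (1 : F.Point) hb) (hpb ▸ hp'))

theorem distrib_of_desargues (hD : 𝒜.Desargues) (A B C : F.Point) :
    A * (B + C) = A * B + A * C ∧ (A + B) * C = A * C + B * C := by
  by_cases h : ∃ E : F.Point, E ≠ 0 ∧ E ≠ 1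
  · obtain ⟨E, h0, h1⟩ := h
    exact ⟨mul_add_of_desargues hD h0 h1 A B C, add_mul_of_desargues hD h0 h1 A B C⟩
  · have h01 : ∀ E : F.Point, E = 0 ∨ E = 1 := fun E => by
      by_contra! hE
      exact h ⟨E, hE⟩
    -- With only two points, `1 + 1` must be `0`, and the neutral-element rules complete both
    -- tables.
    have h2 : (1 : F.Point) + 1 = 0 := (h01 _).resolve_right one_add_one_ne_one
    rcases h01 A with rfl | rfl <;> rcases h01 B with rfl | rfl <;> rcases h01 C with rfl | rfl <;>
      simp only [zero_add_point, add_zero_point, zero_mul_point, one_mul_point, h2, and_self]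

end Frame

end AffinePlane

theorem theorem2p6 {P : Type*} (𝒜 : AffinePlane P) (hD : 𝒜.Desargues) (F : 𝒜.Frame)
    (A C D : F.Point) :
    ∀ fX ∈ AffinePlane.Frame.crossRatioSetB A C D,
    ∀ fY ∈ AffinePlane.Frame.crossRatioSetB A C D,
    ∀ fZ ∈ AffinePlane.Frame.crossRatioSetB A C D,
      fX * (fY + fZ) = fX * fY + fX * fZ ∧
      (fX + fY) * fZ = fX * fZ + fY * fZ :=
  fun fX _ fY _ fZ _ => AffinePlane.Frame.distrib_of_desargues hD fX fY fZ
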